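/- Let $n\ge 1$ and $\alpha_1,\dots,\alpha_n>0$. The Dirichlet distribution $\mathrm{Dir}(\alpha_1,\dots,\alpha_n)$ is the measure on $\mathbb R^n$ carried by the simplex $\{x_1,\dots,x_n\ge 0,\ x_1+\dots+x_n=1\}$ whose density, with respect to Lebesgue measure in the coordinates $(x_1,\dots,x_{n-1})$ (where $x_n=1-x_1-\dots-x_{n-1}$), is $$\frac{\Gamma(\alpha_1+\dots+\alpha_n)}{\Gamma(\alpha_1)\cdots\Gamma(\alpha_n)}\,x_1^{\alpha_1-1}\cdots x_n^{\alpha_n-1}$$ (for $n=1$ it is the point mass at $1$). It is a probability measure. Let $(X_1,\dots,X_n)$ be a random vector with this distribution. Then: (i) (Marginal law) For every $0\le k<n$, the law of $(X_1,\dots,X_k)$ has a density with respect to Lebesgue measure on $\mathbb R^k$ which is proportional to $$x_1^{\alpha_1-1}\cdots x_k^{\alpha_k-1}(1-x_1-\dots-x_k)^{\alpha_{k+1}+\dots+\alpha_n-1}$$ on the region $x_1,\dots,x_k>0$, $x_1+\dots+x_k<1$, and is zero elsewhere. Moreover, if $n\ge2$, then $X_i\sim\mathrm{Beta}\bigl(\alpha_i,\sum_{j\ne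 i}\alpha_j\bigr)$ for every $1\le i\le n$. (ii) (Gamma construction) If $Z_1,\dots,Z_n$ are independent with $Z_i\sim\Gamma(\alpha_i,1)$, then $$(X_1,\dots,X_n)\overset{d}{=}\left(\frac{Z_i}{Z_1+\dots+Z_n}\right)_{i=1}^n .$$ (iii) (Stick-breaking construction) Let $W_1,\dots,W_{n-1}$ be independent with $W_i\sim\mathrm{Beta}(\alpha_i,\alpha_{i+1}+\dots+\alpha_n)$, and put $X_i^*=W_i(1-W_{i-1})\cdots(1-W_1)$ for $1\le i\le n-1$ and $X_n^*=1-X_1^*-\dots-X_{n-1}^*$. Then $$(X_1,\dots,X_n)\overset{d}{=}(X_1^*,\dots,X_n^*).$$ -/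

import Mathlib

open MeasureTheory ProbabilityTheory

/-- The unnormalized density `x₁^(a₁-1) ⋯ x_d^(a_d-1) (1 - x₁ - ⋯ - x_d)^(b-1)` on the region
`x₁, …, x_d > 0`, `x₁ + ⋯ + x_d < 1` of `ℝ^d`, extended by `0`. -/
noncomputable def simplexWeight {d : ℕ} (a : Fin d → ℝ) (b : ℝ) : (Fin d → ℝ) → ℝ :=
  Set.indicator {x : Fin d → ℝ | (∀ i, 0 < x i) ∧ ∑ i, x i < 1}
    (fun x => (∏ i, x i ^ (a i - 1)) * (1 - ∑ i, x i) ^ (b - 1))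

/-- The point `(x₁, …, x_m, 1 - x₁ - ⋯ - x_m)` of the hyperplane of vectors with sum one. -/
noncomputable def simplexPoint {m : ℕ} (x : Fin m → ℝ) : Fin (m + 1) → ℝ :=
  Fin.snoc (α := fun _ => ℝ) x (1 - ∑ i, x i)

theorem measurable_simplexPoint {m : ℕ} : Measurable (simplexPoint (m := m)) := by
  refine measurable_pi_lambda _ fun i => ?_
  refine Fin.lastCases ?_ (fun j => ?_) i
  · simp only [simplexPoint, Fin.snoc_last]
    fun_prop
  · simp only [simplexPoint, Fin.snoc_castSucc]
    fun_prop

theorem measurable_simplexWeight {d : ℕ} (a : Fin d → ℝ) (b : ℝ) :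
    Measurable (simplexWeight a b) := by
  refine Measurable.indicator (by fun_prop) ?_
  refine MeasurableSet.inter ?_ ?_
  · have h : {x : Fin d → ℝ | ∀ i, 0 < x i} = ⋂ i, {x : Fin d → ℝ | 0 < x i} := by
      ext x; simp
    change MeasurableSet {x : Fin d → ℝ | ∀ i, 0 < x i}
    rw [h]
    exact MeasurableSet.iInter fun i => measurableSet_lt (by fun_prop) (by fun_prop)
  · exact measurableSet_lt (f := fun x : Fin d → ℝ => ∑ i, x i) (by fun_prop) (by fun_prop)

/-- The Dirichlet distribution with the `n = m + 1` parameters `α`: the measure on `ℝ^n`, carried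
by the simplex `x₁, …, x_n ≥ 0`, `x₁ + ⋯ + x_n = 1`, whose density with respect to Lebesgue
measure in the coordinates `x₁, …, x_{n-1}` is
`Γ(α₁ + ⋯ + α_n) / (Γ(α₁) ⋯ Γ(α_n)) * x₁^(α₁-1) ⋯ x_n^(α_n-1)`. -/
noncomputable def dirichletMeasure {m : ℕ} (α : Fin (m + 1) → ℝ) : Measure (Fin (m + 1) → ℝ) :=
  Measure.map simplexPoint
    ((volume : Measure (Fin m → ℝ)).withDensity fun x =>
      ENNReal.ofReal (Real.Gamma (∑ i, α i) / (∏ i, Real.Gamma (α i)) *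
        simplexWeight (fun i : Fin m => α i.castSucc) (α (Fin.last m)) x))

/-- Finite stick-breaking: the `i`-th entry is `w_i (1 - w_{i-1}) ⋯ (1 - w₁)` for `i < n = m + 1`,
and the last entry is one minus the sum of the previous ones. -/
noncomputable def stickBreaking {m : ℕ} (w : Fin m → ℝ) : Fin (m + 1) → ℝ :=
  simplexPoint fun i => w i * ∏ j ∈ Finset.Iio i, (1 - w j)

/-!
Everything follows from one recursion, `measurePreserving_consScale_dirichletMeasure`: if
`W ∼ Beta(α₁, α₂ + ⋯ + α_n)` and `Y ∼ Dir(α₂, …, α_n)` are independent, then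
`(W, (1 - W) Y) ∼ Dir(α₁, …, α_n)`. On the level of densities this is Fubini's theorem in the first
coordinate `w`, followed by the dilation by `1 - w` in the other ones, whose Jacobian supplies the
missing power of `1 - w` in the beta density (`simplexWeight_cons_smul`). The case of the density
on `ℝ^k`, `measurePreserving_consScale_simplexMeasure`, is proved first, since the marginal laws
are of that form.

By induction on the number of parameters the recursion gives the total mass, the law of the
stick-breaking vector (one more step of the recursion is one more stick broken off at the front),
and the law of the first `k` coordinates (truncation commutes with the recursion, and does not
change the parameters of `W`).

For the gamma construction, the induction carries along the sum: `(∑ Z, Z / ∑ Z)` has law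
`Γ(∑ α, 1) ⊗ Dir(α)`. The step combines the recursion with the fact that, for independent gamma
variables, `X + Y` and `X / (X + Y)` are independent with gamma and beta laws
(`measurePreserving_add_div_gammaMeasure`).

The recursion shows that the first coordinate is beta-distributed. The gamma construction is
symmetric in the coordinates, hence so is the Dirichlet distribution, and every coordinate is
beta-distributed.
-/

/-! ### Dilations and the recursion for the Dirichlet density -/

theorem lintegral_eq_ofReal_pow_mul_lintegral_comp_smul {E : Type*} [NormedAddCommGroup E]
    [NormedSpace ℝ E] [MeasurableSpace E] [BorelSpace E] [FiniteDimensional ℝ E] (μ : Measure E)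
    [μ.IsAddHaarMeasure] {c : ℝ} (hc : 0 < c) {f : E → ENNReal} (hf : Measurable f) :
    ∫⁻ x, f x ∂μ = ENNReal.ofReal (c ^ Module.finrank ℝ E) * ∫⁻ y, f (c • y) ∂μ := by
  have h : ∫⁻ y, f (c • y) ∂μ = ∫⁻ x, f x ∂(Measure.map (c • ·) μ) :=
    (lintegral_map hf (measurable_const_smul c)).symm
  have hpos : 0 < c ^ Module.finrank ℝ E := by positivity
  rw [h, Measure.map_addHaar_smul μ hc.ne', lintegral_smul_measure, smul_eq_mul, ← mul_assoc,
    ← ENNReal.ofReal_mul hpos.le, abs_of_pos (inv_pos.2 hpos), mul_inv_cancel₀ hpos.ne',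
    ENNReal.ofReal_one, one_mul]

/-- The Dirichlet density on `ℝ^k`, with parameters `a₁, …, a_k` and `b`, normalized, as a measure:
the law of all but the last coordinate of a Dirichlet vector. -/
noncomputable def simplexMeasure {k : ℕ} (a : Fin k → ℝ) (b : ℝ) : Measure (Fin k → ℝ) :=
  (volume : Measure (Fin k → ℝ)).withDensity fun x =>
    ENNReal.ofReal (Real.Gamma (∑ i, a i + b) / ((∏ i, Real.Gamma (a i)) * Real.Gamma b) *
      simplexWeight a b x)

instance sFinite_betaMeasure (a b : ℝ) : SFinite (betaMeasure a b) := by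
  unfold betaMeasure
  infer_instance

instance sFinite_simplexMeasure {k : ℕ} (a : Fin k → ℝ) (b : ℝ) : SFinite (simplexMeasure a b) := by
  unfold simplexMeasure
  infer_instance

/-- One step of stick-breaking: break off a piece of length `w` from a unit stick, and scale the
vector `y` to the remaining piece, of length `1 - w`. -/
def consScale {k : ℕ} (p : ℝ × (Fin k → ℝ)) : Fin (k + 1) → ℝ :=
  Fin.cons p.1 ((1 - p.1) • p.2)

@[simp] theorem consScale_zero {k : ℕ} (p : ℝ × (Fin k → ℝ)) : consScale p 0 = p.1 := rfl

@[simp] theorem consScale_succ {k : ℕ} (p : ℝ × (Fin k → ℝ)) (i : Fin k) :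
    consScale p i.succ = (1 - p.1) * p.2 i := rfl

@[fun_prop]
theorem measurable_consScale {k : ℕ} : Measurable (consScale (k := k)) := by
  refine measurable_pi_lambda _ fun i => ?_
  refine Fin.cases ?_ (fun j => ?_) i
  · simp only [consScale_zero]; fun_prop
  · simp only [consScale_succ]; fun_prop

theorem measurePreserving_cons {k : ℕ} (μ : Fin (k + 1) → Measure ℝ) [∀ i, SigmaFinite (μ i)] :
    MeasurePreserving (fun p : ℝ × (Fin k → ℝ) => (Fin.cons p.1 p.2 : Fin (k + 1) → ℝ))
      ((μ 0).prod (Measure.pi fun j => μ j.succ)) (Measure.pi μ) := by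
  have h := (measurePreserving_piFinSuccAbove μ 0).symm
  have he : (fun p : ℝ × (Fin k → ℝ) => (Fin.cons p.1 p.2 : Fin (k + 1) → ℝ)) =
      (MeasurableEquiv.piFinSuccAbove (fun _ => ℝ) 0).symm :=
    funext fun p => (Fin.insertNth_zero' p.1 p.2).symm
  rw [he]
  exact h

/-- The unnormalized density in the coordinates `(w, (1 - w) y)` splits into a beta density in `w`
and a density of the same kind in `y`. The factor `(1 - w) ^ k` is the Jacobian of the dilation. -/
theorem simplexWeight_cons_smul {k : ℕ} (a : Fin (k + 1) → ℝ) (b w : ℝ) (hw0 : 0 < w) (hw1 : w < 1)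
    (y : Fin k → ℝ) :
    (1 - w) ^ k * simplexWeight a b (Fin.cons w ((1 - w) • y)) =
      w ^ (a 0 - 1) * (1 - w) ^ ((∑ i : Fin k, a i.succ) + b - 1) *
        simplexWeight (fun i => a i.succ) b y := by
  have hw : 0 < 1 - w := sub_pos.2 hw1
  have hsum : ∑ i, (Fin.cons w ((1 - w) • y) : Fin (k + 1) → ℝ) i = w + (1 - w) * ∑ i, y i := by
    simp [Fin.sum_univ_succ, Finset.mul_sum]
  have hrem : 1 - (w + (1 - w) * ∑ i, y i) = (1 - w) * (1 - ∑ i, y i) := by ring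
  have hmem : (Fin.cons w ((1 - w) • y) : Fin (k + 1) → ℝ) ∈
      {x : Fin (k + 1) → ℝ | (∀ i, 0 < x i) ∧ ∑ i, x i < 1} ↔
      y ∈ {x : Fin k → ℝ | (∀ i, 0 < x i) ∧ ∑ i, x i < 1} := by
    have h : w + (1 - w) * ∑ i, y i < 1 ↔ ∑ i, y i < 1 := by
      rw [← sub_pos, hrem, mul_pos_iff_of_pos_left hw, sub_pos]
    simp only [Set.mem_ofPred_eq, hsum, h, Fin.forall_fin_succ, Fin.cons_zero, Fin.cons_succ,
      Pi.smul_apply, smul_eq_mul, mul_pos_iff_of_pos_left hw, hw0, true_and]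
  unfold simplexWeight
  by_cases hy : y ∈ {x : Fin k → ℝ | (∀ i, 0 < x i) ∧ ∑ i, x i < 1}
  · rw [Set.indicator_of_mem (hmem.2 hy), Set.indicator_of_mem hy, hsum, hrem,
      Fin.prod_univ_succ]
    simp only [Fin.cons_zero, Fin.cons_succ, Pi.smul_apply, smul_eq_mul]
    rw [Finset.prod_congr rfl fun i _ => Real.mul_rpow hw.le (hy.1 i).le, Finset.prod_mul_distrib,
      Real.mul_rpow hw.le (sub_pos.2 hy.2).le]
    have key : (1 - w) ^ ((∑ i : Fin k, a i.succ) + b - 1) =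
        (1 - w) ^ k * (∏ i : Fin k, (1 - w) ^ (a i.succ - 1)) * (1 - w) ^ (b - 1) := by
      rw [← Real.rpow_sum_of_pos hw, ← Real.rpow_natCast, ← Real.rpow_add hw, ← Real.rpow_add hw]
      congr 1
      simp only [Finset.sum_sub_distrib, Finset.sum_const, Finset.card_univ, Fintype.card_fin,
        nsmul_eq_mul]
      ring
    rw [key]
    ring
  · rw [Set.indicator_of_notMem (fun h => hy (hmem.1 h)), Set.indicator_of_notMem hy]
    simp

theorem simplexWeight_cons_eq_zero {k : ℕ} (a : Fin (k + 1) → ℝ) (b w : ℝ)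
    (hw : ¬(0 < w ∧ w < 1)) (y : Fin k → ℝ) : simplexWeight a b (Fin.cons w y) = 0 := by
  refine Set.indicator_of_notMem (fun h => hw ⟨by simpa using h.1 0, ?_⟩) _
  have h0 : 0 ≤ ∑ i, y i := Finset.sum_nonneg fun i _ => by simpa using (h.1 i.succ).le
  have h1 := h.2
  rw [Fin.sum_univ_succ] at h1
  simp only [Fin.cons_zero, Fin.cons_succ] at h1
  linarith

theorem measurable_betaPDF (a b : ℝ) : Measurable (betaPDF a b) :=
  (measurable_betaPDFReal a b).ennreal_ofReal

theorem measurable_gammaPDF (a r : ℝ) : Measurable (gammaPDF a r) :=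
  (measurable_gammaPDFReal a r).ennreal_ofReal

/-- The density form of the recursion for Dirichlet vectors. -/
theorem measurePreserving_consScale_simplexMeasure {k : ℕ} (a : Fin (k + 1) → ℝ) (b : ℝ)
    (ha : ∀ i, 0 < a i) (hb : 0 < b) :
    MeasurePreserving consScale
      ((betaMeasure (a 0) (∑ i : Fin k, a i.succ + b)).prod
        (simplexMeasure (fun i : Fin k => a i.succ) b)) (simplexMeasure a b) := by
  have hA : 0 < ∑ i : Fin k, a i.succ + b :=
    add_pos_of_nonneg_of_pos (Finset.sum_nonneg fun i _ => (ha _).le) hb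
  refine ⟨measurable_consScale, Measure.ext_of_lintegral _ fun f hf => ?_⟩
  have hm := measurable_simplexWeight a b
  have hm' := measurable_simplexWeight (fun i : Fin k => a i.succ) b
  have hB := measurable_betaPDF (a 0) (∑ i : Fin k, a i.succ + b)
  have hcons : MeasurePreserving
      (fun p : ℝ × (Fin k → ℝ) => (Fin.cons p.1 p.2 : Fin (k + 1) → ℝ))
      (volume.prod volume) volume :=
    measurePreserving_cons fun _ => volume
  rw [lintegral_map hf measurable_consScale, betaMeasure, simplexMeasure, simplexMeasure,
    prod_withDensity hB (by fun_prop), lintegral_withDensity_eq_lintegral_mul _ (by fun_prop)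
      (by fun_prop), lintegral_withDensity_eq_lintegral_mul _ (by fun_prop) hf]
  rw [← hcons.lintegral_comp (by fun_prop),
    lintegral_prod _ (by fun_prop), lintegral_prod _ (by fun_prop)]
  refine lintegral_congr fun w => ?_
  simp only [Pi.mul_apply]
  by_cases hw : 0 < w ∧ w < 1
  · have hw1 : 0 < 1 - w := sub_pos.2 hw.2
    -- substitute `(1 - w) • y` for the last `k` coordinates on the right-hand side
    symm
    rw [lintegral_eq_ofReal_pow_mul_lintegral_comp_smul (c := 1 - w) _ hw1 (by fun_prop),
      ← lintegral_const_mul _ (by fun_prop)]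
    refine lintegral_congr fun y => ?_
    rw [← mul_assoc, ← ENNReal.ofReal_mul (by positivity), Module.finrank_fin_fun,
      mul_left_comm, simplexWeight_cons_smul a b w hw.1 hw.2, betaPDF_of_pos_lt_one hw.1 hw.2,
      ← ENNReal.ofReal_mul]
    · congr 2
      rw [beta, Fin.prod_univ_succ, Fin.sum_univ_succ, ← add_assoc]
      have h1 := (Real.Gamma_pos_of_pos hA).ne'
      field_simp
    · have := beta_pos (ha 0) hA
      have := hw.1
      positivity
  · have h0 : betaPDF (a 0) (∑ i : Fin k, a i.succ + b) w = 0 := by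
      rw [betaPDF_eq, if_neg hw, ENNReal.ofReal_zero]
    simp [h0, simplexWeight_cons_eq_zero a b w hw]

theorem simplexMeasure_zero (a : Fin 0 → ℝ) {b : ℝ} (hb : 0 < b) :
    simplexMeasure a b = volume := by
  have h : (fun x : Fin 0 → ℝ => ENNReal.ofReal (Real.Gamma (∑ i, a i + b) /
      ((∏ i, Real.Gamma (a i)) * Real.Gamma b) * simplexWeight a b x)) = 1 := by
    funext x
    simp [simplexWeight, (Real.Gamma_pos_of_pos hb).ne']
  rw [simplexMeasure, h, withDensity_one]

/-- The recursion reduces the normalization of the Dirichlet density to that of the beta density. -/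
theorem isProbabilityMeasure_simplexMeasure {k : ℕ} (a : Fin k → ℝ) {b : ℝ} (ha : ∀ i, 0 < a i)
    (hb : 0 < b) : IsProbabilityMeasure (simplexMeasure a b) := by
  induction k with
  | zero =>
    rw [simplexMeasure_zero a hb, Measure.volume_pi_eq_dirac 0]
    infer_instance
  | succ k ih =>
    have := ih (fun i => a i.succ) fun i => ha _
    have := isProbabilityMeasureBeta (ha 0)
      (add_pos_of_nonneg_of_pos
        (Finset.sum_nonneg (s := Finset.univ) fun (i : Fin k) _ => (ha i.succ).le) hb)
    have h := measurePreserving_consScale_simplexMeasure a b ha hb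
    rw [← h.map_eq]
    exact Measure.isProbabilityMeasure_map h.aemeasurable

/-! ### The recursion for the Dirichlet distribution -/

theorem dirichletMeasure_eq_map_simplexMeasure {m : ℕ} (α : Fin (m + 1) → ℝ) :
    dirichletMeasure α =
      (simplexMeasure (fun i : Fin m => α i.castSucc) (α (Fin.last m))).map simplexPoint := by
  rw [dirichletMeasure, simplexMeasure, Fin.sum_univ_castSucc, Fin.prod_univ_castSucc]

theorem isProbabilityMeasure_dirichletMeasure {m : ℕ} {α : Fin (m + 1) → ℝ} (hα : ∀ i, 0 < α i) :
    IsProbabilityMeasure (dirichletMeasure α) := by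
  have := isProbabilityMeasure_simplexMeasure (fun i : Fin m => α i.castSucc) (fun i => hα _)
    (hα (Fin.last m))
  rw [dirichletMeasure_eq_map_simplexMeasure]
  exact Measure.isProbabilityMeasure_map measurable_simplexPoint.aemeasurable

theorem simplexPoint_consScale {m : ℕ} (p : ℝ × (Fin m → ℝ)) :
    simplexPoint (consScale p) = consScale (p.1, simplexPoint p.2) := by
  funext i
  refine Fin.cases ?_ (fun i => ?_) i
  · rw [consScale_zero, ← Fin.castSucc_zero, simplexPoint, Fin.snoc_castSucc, consScale_zero]
  · refine Fin.lastCases ?_ (fun j => ?_) i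
    · rw [consScale_succ, Fin.succ_last]
      simp only [simplexPoint, Fin.snoc_last, Fin.sum_univ_succ, consScale_zero, consScale_succ,
        ← Finset.mul_sum]
      ring
    · rw [consScale_succ, Fin.succ_castSucc]
      simp only [simplexPoint, Fin.snoc_castSucc, consScale_succ]

/-- The recursion behind every part of the theory: a Dirichlet vector with `m + 2` parameters is
obtained by breaking off a beta-distributed first coordinate and scaling an independent Dirichlet
vector in the other `m + 1` parameters to what remains. -/
theorem measurePreserving_consScale_dirichletMeasure {m : ℕ} {α : Fin (m + 2) → ℝ}
    (hα : ∀ i, 0 < α i) :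
    MeasurePreserving consScale ((betaMeasure (α 0) (∑ i : Fin (m + 1), α i.succ)).prod
      (dirichletMeasure fun i => α i.succ)) (dirichletMeasure α) := by
  have h := measurePreserving_consScale_simplexMeasure (fun i : Fin (m + 1) => α i.castSucc)
    (α (Fin.last _)) (fun i => hα _) (hα _)
  refine ⟨measurable_consScale, ?_⟩
  have hs : ∑ i : Fin (m + 1), α i.succ =
      ∑ i : Fin m, α i.succ.castSucc + α (Fin.last (m + 1)) := by
    rw [Fin.sum_univ_castSucc]
    rfl
  rw [dirichletMeasure_eq_map_simplexMeasure, dirichletMeasure_eq_map_simplexMeasure, ← h.map_eq,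
    Measure.map_map measurable_simplexPoint measurable_consScale]
  nth_rw 1 [← Measure.map_id (μ := betaMeasure (α 0) (∑ i : Fin (m + 1), α i.succ))]
  rw [Measure.map_prod_map _ _ measurable_id measurable_simplexPoint,
    Measure.map_map measurable_consScale (measurable_id.prodMap measurable_simplexPoint), hs]
  have hc : simplexPoint ∘ consScale =
      consScale ∘ Prod.map id (simplexPoint (m := m)) := funext simplexPoint_consScale
  rw [hc]
  rfl

theorem dirichletMeasure_one {α : Fin 1 → ℝ} (hα : ∀ i, 0 < α i) :
    dirichletMeasure α = Measure.dirac 1 := by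
  rw [dirichletMeasure_eq_map_simplexMeasure, simplexMeasure_zero _ (hα _),
    Measure.volume_pi_eq_dirac 0, Measure.map_dirac' measurable_simplexPoint]
  congr 1
  funext i
  rw [Fin.fin_one_eq_zero i, ← Fin.last_zero, simplexPoint, Fin.snoc_last]
  simp

/-! ### Stick-breaking -/

theorem measurable_stickBreaking {m : ℕ} : Measurable (stickBreaking (m := m)) :=
  measurable_simplexPoint.comp (by fun_prop)

theorem stickBreaking_cons {m : ℕ} (w : ℝ) (v : Fin m → ℝ) :
    stickBreaking (Fin.cons w v : Fin (m + 1) → ℝ) = consScale (w, stickBreaking v) := by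
  rw [stickBreaking, stickBreaking, ← simplexPoint_consScale (w, _)]
  congr 1
  funext i
  refine Fin.cases ?_ (fun j => ?_) i
  · have h : Finset.Iio (0 : Fin (m + 1)) = ∅ := by ext j; simp
    simp [h]
  · have h : Finset.Iio j.succ = insert 0 ((Finset.Iio j).map (Fin.succEmb m)) := by
      ext i
      refine Fin.cases ?_ (fun i => ?_) i <;> simp
    rw [consScale_succ, h, Finset.prod_insert (by simp), Finset.prod_map]
    simp
    ring

theorem measurePreserving_stickBreaking {m : ℕ} {α : Fin (m + 1) → ℝ} (hα : ∀ i, 0 < α i) :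
    MeasurePreserving stickBreaking (Measure.pi fun i : Fin m =>
      betaMeasure (α i.castSucc) (∑ j : Fin (m + 1) with i.castSucc < j, α j))
      (dirichletMeasure α) := by
  induction m with
  | zero =>
    refine ⟨measurable_stickBreaking, ?_⟩
    rw [dirichletMeasure_one hα, Measure.pi_of_empty _ 0,
      Measure.map_dirac' measurable_stickBreaking]
    congr 1
    funext i
    rw [Fin.fin_one_eq_zero i, ← Fin.last_zero, stickBreaking, simplexPoint, Fin.snoc_last]
    simp
  | succ m ih =>
    have hβ {n : ℕ} {α : Fin (n + 1) → ℝ} (hα : ∀ i, 0 < α i) (i : Fin n) : IsProbabilityMeasure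
        (betaMeasure (α i.castSucc) (∑ j : Fin (n + 1) with i.castSucc < j, α j)) :=
      isProbabilityMeasureBeta (hα _) (Finset.sum_pos (fun j _ => hα j) ⟨i.succ, by simp⟩)
    have := hβ hα
    have := hβ (α := fun i => α i.succ) fun i => hα _
    have hc := measurePreserving_cons fun i : Fin (m + 1) =>
      betaMeasure (α i.castSucc) (∑ j : Fin (m + 2) with i.castSucc < j, α j)
    have h0 : ∑ j : Fin (m + 2) with (0 : Fin (m + 1)).castSucc < j, α j =
        ∑ j : Fin (m + 1), α j.succ := by
      rw [Finset.sum_filter, Fin.sum_univ_succ]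
      simp
    have hs (i : Fin m) : ∑ j : Fin (m + 2) with i.succ.castSucc < j, α j =
        ∑ j : Fin (m + 1) with i.castSucc < j, α j.succ := by
      rw [Finset.sum_filter, Fin.sum_univ_succ, Finset.sum_filter, ← Fin.succ_castSucc]
      simp
    have ih' := ih (α := fun i => α i.succ) fun i => hα _
    have := isProbabilityMeasure_dirichletMeasure (α := fun i => α i.succ) fun i => hα _
    have hmain := (measurePreserving_consScale_dirichletMeasure hα).comp
      ((MeasurePreserving.id _).prod ih')
    refine ⟨measurable_stickBreaking, ?_⟩
    rw [← hc.map_eq, Measure.map_map measurable_stickBreaking hc.measurable, ← hmain.map_eq, h0]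
    simp only [hs]
    congr 1
    funext p
    exact stickBreaking_cons p.1 p.2

/-! ### Marginal laws of initial segments -/

theorem sum_castLE_add_sum_filter_le {n : ℕ} (f : Fin n → ℝ) {k : ℕ} (hk : k ≤ n) :
    ∑ i : Fin k, f (Fin.castLE hk i) + ∑ j : Fin n with k ≤ j.val, f j = ∑ j, f j := by
  rw [← Finset.sum_filter_add_sum_filter_not Finset.univ (fun j : Fin n => j.val < k)]
  simp only [not_lt]
  congr 1
  have h : (Finset.univ.filter fun j : Fin n => j.val < k) =
      Finset.univ.map (Fin.castLEEmb hk) := by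
    ext j
    simp only [Finset.mem_filter, Finset.mem_univ, true_and, Finset.mem_map, Fin.coe_castLEEmb]
    exact ⟨fun h => ⟨⟨j, h⟩, rfl⟩, by rintro ⟨i, rfl⟩; exact i.2⟩
  rw [h, Finset.sum_map]
  rfl

/-- The first `k` coordinates of a Dirichlet vector have the Dirichlet density in which the
remaining parameters are merged into one. -/
theorem measurePreserving_castLE_dirichletMeasure {m : ℕ} {α : Fin (m + 1) → ℝ}
    (hα : ∀ i, 0 < α i) {k : ℕ} (hk : k < m + 1) :
    MeasurePreserving (fun (x : Fin (m + 1) → ℝ) (i : Fin k) => x (Fin.castLE hk.le i))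
      (dirichletMeasure α) (simplexMeasure (fun i : Fin k => α (Fin.castLE hk.le i))
        (∑ j : Fin (m + 1) with k ≤ j.val, α j)) := by
  have hpos {m k : ℕ} {α : Fin (m + 1) → ℝ} (hα : ∀ i, 0 < α i) (hk : k < m + 1) :
      0 < ∑ j : Fin (m + 1) with k ≤ j.val, α j :=
    Finset.sum_pos (fun j _ => hα j) ⟨⟨k, hk⟩, by simp⟩
  refine ⟨by fun_prop, ?_⟩
  induction k generalizing m with
  | zero =>
    have := isProbabilityMeasure_dirichletMeasure hα
    -- both sides are probability measures on a one-point space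
    have h : (fun (x : Fin (m + 1) → ℝ) (i : Fin 0) => x (Fin.castLE hk.le i)) = fun _ => 0 :=
      Subsingleton.elim _ _
    rw [simplexMeasure_zero _ (hpos hα hk), Measure.volume_pi_eq_dirac 0, h, Measure.map_const,
      measure_univ, one_smul]
  | succ k ih =>
    obtain ⟨m, rfl⟩ : ∃ l, m = l + 1 := ⟨m - 1, by omega⟩
    have hk' : k < m + 1 := by omega
    have ih' := ih (α := fun i => α i.succ) (fun i => hα _) hk'
    have := isProbabilityMeasure_dirichletMeasure (α := fun i => α i.succ) fun i => hα _
    have hs : ∑ j : Fin (m + 2) with k + 1 ≤ j.val, α j =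
        ∑ j : Fin (m + 1) with k ≤ j.val, α j.succ := by
      rw [Finset.sum_filter, Fin.sum_univ_succ, Finset.sum_filter]
      simp
    have hd := measurePreserving_consScale_dirichletMeasure hα
    have hsimp := measurePreserving_consScale_simplexMeasure
      (fun i : Fin (k + 1) => α (Fin.castLE hk.le i))
      (∑ j : Fin (m + 1) with k ≤ j.val, α j.succ) (fun i => hα _)
      (hpos (α := fun i => α i.succ) (fun i => hα _) hk')
    have hsum : ∑ i : Fin k, α (Fin.castLE hk.le i.succ) +
        ∑ j : Fin (m + 1) with k ≤ j.val, α j.succ = ∑ j : Fin (m + 1), α j.succ :=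
      sum_castLE_add_sum_filter_le (fun j : Fin (m + 1) => α j.succ) hk'.le
    rw [hsum] at hsimp
    have hih : MeasurePreserving (fun (x : Fin (m + 1) → ℝ) (i : Fin k) => x (Fin.castLE hk'.le i))
      _ _ := ⟨by fun_prop, ih'⟩
    have hmain := hsimp.comp ((MeasurePreserving.id _).prod hih)
    rw [hs, ← hmain.map_eq, ← hd.map_eq, Measure.map_map (by fun_prop) measurable_consScale]
    congr 1
    funext p i
    refine Fin.cases ?_ (fun i => ?_) i <;> rfl

theorem measurePreserving_eval_zero_dirichletMeasure {m : ℕ} {α : Fin (m + 2) → ℝ}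
    (hα : ∀ i, 0 < α i) :
    MeasurePreserving (fun x : Fin (m + 2) → ℝ => x 0) (dirichletMeasure α)
      (betaMeasure (α 0) (∑ i : Fin (m + 1), α i.succ)) := by
  have := isProbabilityMeasure_dirichletMeasure (α := fun i => α i.succ) fun i => hα _
  have hd := measurePreserving_consScale_dirichletMeasure hα
  refine ⟨by fun_prop, ?_⟩
  rw [← hd.map_eq, Measure.map_map (by fun_prop) measurable_consScale]
  exact measurePreserving_fst.map_eq

/-! ### Sum and ratio of two gamma variables -/

/-- The joint density of `X` and `Y` in the coordinates `s = X + Y` and `w = X / (X + Y)`; the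
factor `s` is the Jacobian. The points `w = 0` and `w = 1` are excluded because the gamma density is
not set to `0` at the origin. -/
theorem gammaPDF_mul_gammaPDF_eq_gammaPDF_mul_betaPDF {a b s w : ℝ} (ha : 0 < a) (hb : 0 < b)
    (hs : 0 < s) (hw0 : w ≠ 0) (hw1 : w ≠ 1) :
    ENNReal.ofReal s * (gammaPDF a 1 (s * w) * gammaPDF b 1 (s - s * w)) =
      gammaPDF (a + b) 1 s * betaPDF a b w := by
  have hsw : s - s * w = s * (1 - w) := by ring
  rcases lt_or_gt_of_ne hw0 with h | h
  · rw [gammaPDF_of_neg (mul_neg_of_pos_of_neg hs h), betaPDF_eq_zero_of_nonpos h.le]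
    simp
  rcases lt_or_gt_of_ne hw1 with h' | h'
  · have h1 : 0 < 1 - w := sub_pos.2 h'
    have hga := Real.Gamma_pos_of_pos ha
    have hgb := Real.Gamma_pos_of_pos hb
    have hgab := Real.Gamma_pos_of_pos (add_pos ha hb)
    rw [hsw, gammaPDF_of_nonneg (by positivity), gammaPDF_of_nonneg (by positivity),
      gammaPDF_of_nonneg hs.le, betaPDF_of_pos_lt_one h h', ← ENNReal.ofReal_mul (by positivity),
      ← ENNReal.ofReal_mul hs.le, ← ENNReal.ofReal_mul (by positivity)]
    congr 1
    have hexp : Real.exp (-(1 * s)) =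
        Real.exp (-(1 * (s * w))) * Real.exp (-(1 * (s * (1 - w)))) := by
      rw [← Real.exp_add]; congr 1; ring
    have hpow : s ^ (a + b - 1) = s * s ^ (a - 1) * s ^ (b - 1) := by
      nth_rw 2 [← Real.rpow_one s]
      rw [← Real.rpow_add hs, ← Real.rpow_add hs]; congr 1; ring
    rw [hexp, hpow, Real.mul_rpow hs.le h.le, Real.mul_rpow hs.le h1.le, beta]
    simp only [Real.one_rpow]
    field_simp
  · rw [hsw, gammaPDF_of_neg (x := s * (1 - w)) (mul_neg_of_pos_of_neg hs (by linarith)),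
      betaPDF_eq_zero_of_one_le h'.le]
    simp

/-- For independent `X ∼ Γ(a, 1)` and `Y ∼ Γ(b, 1)`, the sum `X + Y ∼ Γ(a + b, 1)` and the ratio
`X / (X + Y) ∼ Beta(a, b)` are independent. -/
theorem measurePreserving_add_div_gammaMeasure {a b : ℝ} (ha : 0 < a) (hb : 0 < b) :
    MeasurePreserving (fun p : ℝ × ℝ => (p.1 + p.2, p.1 / (p.1 + p.2)))
      ((gammaMeasure a 1).prod (gammaMeasure b 1))
      ((gammaMeasure (a + b) 1).prod (betaMeasure a b)) := by
  have hm : Measurable fun p : ℝ × ℝ => (p.1 + p.2, p.1 / (p.1 + p.2)) := by fun_prop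
  refine ⟨hm, Measure.ext_of_lintegral _ fun f hf => ?_⟩
  have hga := measurable_gammaPDF a 1
  have hgb := measurable_gammaPDF b 1
  have hgab := measurable_gammaPDF (a + b) 1
  have hB := measurable_betaPDF a b
  rw [lintegral_map hf hm, gammaMeasure, gammaMeasure, gammaMeasure, betaMeasure,
    prod_withDensity hga hgb, prod_withDensity hgab hB,
    lintegral_withDensity_eq_lintegral_mul _ (by fun_prop) (by fun_prop),
    lintegral_withDensity_eq_lintegral_mul _ (by fun_prop) hf, lintegral_prod _ (by fun_prop),
    lintegral_prod _ (by fun_prop)]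
  simp only [Pi.mul_apply]
  -- translate the second variable by the first, to make the sum a coordinate
  have hshift (x : ℝ) : ∫⁻ y, gammaPDF a 1 x * gammaPDF b 1 y * f (x + y, x / (x + y)) =
      ∫⁻ s, gammaPDF a 1 x * gammaPDF b 1 (s - x) * f (s, x / s) := by
    rw [← lintegral_add_left_eq_self (fun s => gammaPDF a 1 x * gammaPDF b 1 (s - x) *
      f (s, x / s)) x]
    simp only [add_sub_cancel_left]
  simp only [hshift]
  rw [lintegral_lintegral_swap (by fun_prop)]
  have hne (c : ℝ) : ∀ᵐ x : ℝ, x ≠ c := by simp [ae_iff]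
  refine lintegral_congr_ae ?_
  filter_upwards [hne 0] with s hs
  rcases lt_or_gt_of_ne hs with hs | hs
  · rw [gammaPDF_of_neg hs]
    simp only [zero_mul, lintegral_zero]
    refine (lintegral_congr fun x => ?_).trans lintegral_zero
    rcases lt_or_ge x 0 with hx | hx
    · simp [gammaPDF_of_neg hx]
    · simp [gammaPDF_of_neg (x := s - x) (by linarith)]
  -- dilate by the sum, to make the ratio a coordinate
  · rw [lintegral_eq_ofReal_pow_mul_lintegral_comp_smul _ hs (by fun_prop),
      ← lintegral_const_mul _ (by fun_prop)]
    refine lintegral_congr_ae ?_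
    filter_upwards [hne 0, hne 1] with w hw0 hw1
    rw [Module.finrank_self, pow_one, smul_eq_mul, mul_div_cancel_left₀ _ hs.ne', ← mul_assoc,
      gammaPDF_mul_gammaPDF_eq_gammaPDF_mul_betaPDF ha hb hs hw0 hw1]

/-! ### The gamma construction and symmetry -/

instance sFinite_gammaMeasure (a r : ℝ) : SFinite (gammaMeasure a r) := by
  unfold gammaMeasure
  infer_instance

theorem ae_pos_gammaMeasure (a r : ℝ) : ∀ᵐ x ∂(gammaMeasure a r), 0 < x := by
  rw [gammaMeasure, ae_withDensity_iff (measurable_gammaPDF a r)]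
  have hne : ∀ᵐ x : ℝ, x ≠ 0 := by simp [ae_iff]
  filter_upwards [hne] with x hx h
  exact lt_of_le_of_ne (not_lt.1 fun hneg => h (gammaPDF_of_neg hneg)) hx.symm

/-- The sum and the normalization of a vector of independent gamma variables are independent, with
a gamma and a Dirichlet law. -/
theorem measurePreserving_sum_normalize_gammaMeasure {m : ℕ} {α : Fin (m + 1) → ℝ}
    (hα : ∀ i, 0 < α i) :
    MeasurePreserving (fun z : Fin (m + 1) → ℝ => (∑ j, z j, fun i => z i / ∑ j, z j))
      (Measure.pi fun i => gammaMeasure (α i) 1)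
      ((gammaMeasure (∑ i, α i) 1).prod (dirichletMeasure α)) := by
  have hmeas : Measurable fun z : Fin (m + 1) → ℝ => (∑ j, z j, fun i => z i / ∑ j, z j) := by
    fun_prop
  have hγ (i) : IsProbabilityMeasure (gammaMeasure (α i) 1) :=
    isProbabilityMeasure_gammaMeasure (hα i) one_pos
  refine ⟨hmeas, ?_⟩
  have hpos : ∀ᵐ z ∂(Measure.pi fun i => gammaMeasure (α i) 1), ∀ i, 0 < z i :=
    ae_all_iff.2 fun i => (measurePreserving_eval _ i).quasiMeasurePreserving.ae
      (ae_pos_gammaMeasure (α i) 1)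
  induction m with
  | zero =>
    have h1 : MeasurePreserving (fun z : Fin 1 → ℝ => z 0)
        (Measure.pi fun i => gammaMeasure (α i) 1) (gammaMeasure (α 0) 1) :=
      measurePreserving_eval _ 0
    rw [dirichletMeasure_one hα, Measure.prod_dirac, Fin.sum_univ_one, ← h1.map_eq,
      Measure.map_map (by fun_prop) h1.measurable]
    refine Measure.map_congr ?_
    filter_upwards [hpos] with z hz
    refine Prod.ext (Fin.sum_univ_one z) (funext fun i => ?_)
    rw [Fin.fin_one_eq_zero i]
    simp [(hz 0).ne']
  | succ m ih =>
    have hα' (i : Fin (m + 1)) : 0 < α i.succ := hα _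
    have hpos' : ∀ᵐ z ∂(Measure.pi fun i : Fin (m + 1) => gammaMeasure (α i.succ) 1),
        ∀ i, 0 < z i :=
      ae_all_iff.2 fun i => (measurePreserving_eval _ i).quasiMeasurePreserving.ae
        (ae_pos_gammaMeasure (α i.succ) 1)
    have hS' : 0 < ∑ i : Fin (m + 1), α i.succ := Finset.sum_pos (fun i _ => hα' i) (by simp)
    have := isProbabilityMeasure_dirichletMeasure hα'
    have ih' : MeasurePreserving _ _ _ :=
      ⟨by fun_prop, ih (α := fun i => α i.succ) hα' (by fun_prop) (fun i => hγ _) hpos'⟩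
    have hcons := measurePreserving_cons fun i => gammaMeasure (α i) 1
    -- `(z₀, z') ↦ (z₀, S', y') ↦ (z₀ + S', z₀ / (z₀ + S'), y') ↦ (z₀ + S', x)`
    have h1 := (MeasurePreserving.id (gammaMeasure (α 0) 1)).prod ih'
    have h2 := (measurePreserving_prodAssoc (gammaMeasure (α 0) 1)
      (gammaMeasure (∑ i : Fin (m + 1), α i.succ) 1)
      (dirichletMeasure fun i : Fin (m + 1) => α i.succ)).symm
    have h3 := (measurePreserving_add_div_gammaMeasure (hα 0) hS').prod
      (MeasurePreserving.id (dirichletMeasure fun i : Fin (m + 1) => α i.succ))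
    have h4 := measurePreserving_prodAssoc
      (gammaMeasure (α 0 + ∑ i : Fin (m + 1), α i.succ) 1)
      (betaMeasure (α 0) (∑ i : Fin (m + 1), α i.succ))
      (dirichletMeasure fun i : Fin (m + 1) => α i.succ)
    have h5 := (MeasurePreserving.id (gammaMeasure (α 0 + ∑ i : Fin (m + 1), α i.succ) 1)).prod
      (measurePreserving_consScale_dirichletMeasure hα)
    have h := h5.comp (h4.comp (h3.comp (h2.comp h1)))
    rw [Fin.sum_univ_succ, ← h.map_eq, ← hcons.map_eq, Measure.map_map hmeas hcons.measurable]
    refine Measure.map_congr ?_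
    have hp : ∀ᵐ p ∂((gammaMeasure (α 0) 1).prod
        (Measure.pi fun i : Fin (m + 1) => gammaMeasure (α i.succ) 1)),
        0 < p.1 ∧ ∀ i, 0 < p.2 i := by
      filter_upwards [Measure.quasiMeasurePreserving_fst.ae (ae_pos_gammaMeasure (α 0) 1),
        Measure.quasiMeasurePreserving_snd.ae hpos'] with p h1 h2 using ⟨h1, h2⟩
    filter_upwards [hp] with p hp
    obtain ⟨z, z'⟩ := p
    have hz : 0 < z := hp.1
    have hs : 0 < ∑ j, z' j := Finset.sum_pos (fun i _ => hp.2 i) (by simp)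
    have hsum : ∑ j, (Fin.cons z z' : Fin (m + 2) → ℝ) j = z + ∑ j, z' j := by
      simp [Fin.sum_univ_succ]
    refine Prod.ext hsum (funext fun i => ?_)
    change (Fin.cons z z' : Fin (m + 2) → ℝ) i / ∑ j, (Fin.cons z z' : Fin (m + 2) → ℝ) j =
      consScale (z / (z + ∑ j, z' j), fun i => z' i / ∑ j, z' j) i
    rw [hsum]
    refine Fin.cases rfl (fun i => ?_) i
    rw [Fin.cons_succ, consScale_succ]
    field_simp
    ring

theorem measurePreserving_normalize_gammaMeasure {m : ℕ} {α : Fin (m + 1) → ℝ}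
    (hα : ∀ i, 0 < α i) :
    MeasurePreserving (fun (z : Fin (m + 1) → ℝ) i => z i / ∑ j, z j)
      (Measure.pi fun i => gammaMeasure (α i) 1) (dirichletMeasure α) := by
  have := isProbabilityMeasure_gammaMeasure
    (Finset.sum_pos (fun i _ => hα i) Finset.univ_nonempty) one_pos
  have := isProbabilityMeasure_dirichletMeasure hα
  exact measurePreserving_snd.comp (measurePreserving_sum_normalize_gammaMeasure hα)

/-- Permuting the parameters of a Dirichlet vector amounts to permuting its coordinates. The
density singles out the last coordinate, but the gamma construction is manifestly symmetric. -/
theorem measurePreserving_comp_perm_dirichletMeasure {m : ℕ} {α : Fin (m + 1) → ℝ}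
    (hα : ∀ i, 0 < α i) (σ : Equiv.Perm (Fin (m + 1))) :
    MeasurePreserving (fun (x : Fin (m + 1) → ℝ) i => x (σ i)) (dirichletMeasure α)
      (dirichletMeasure fun i => α (σ i)) := by
  have hγ (i) : IsProbabilityMeasure (gammaMeasure (α i) 1) :=
    isProbabilityMeasure_gammaMeasure (hα i) one_pos
  have h1 := measurePreserving_normalize_gammaMeasure hα
  have h2 := measurePreserving_normalize_gammaMeasure (α := fun i => α (σ i)) fun i => hα _
  have h3 := (measurePreserving_piCongrLeft (fun i => gammaMeasure (α i) 1) σ).symm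
  refine ⟨by fun_prop, ?_⟩
  rw [← h1.map_eq, ← (h2.comp h3).map_eq, Measure.map_map (by fun_prop) h1.measurable]
  congr 1
  funext z i
  have h (i) : (MeasurableEquiv.piCongrLeft (fun _ => ℝ) σ).symm z i = z (σ i) := rfl
  simp only [Function.comp_apply, h, Equiv.sum_comp σ z]

theorem measurePreserving_eval_dirichletMeasure {m : ℕ} {α : Fin (m + 2) → ℝ}
    (hα : ∀ i, 0 < α i) (i : Fin (m + 2)) :
    MeasurePreserving (fun x : Fin (m + 2) → ℝ => x i) (dirichletMeasure α)
      (betaMeasure (α i) (∑ j with j ≠ i, α j)) := by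
  have h := (measurePreserving_eval_zero_dirichletMeasure
    (α := fun j => α (Equiv.swap 0 i j)) fun j => hα _).comp
    (measurePreserving_comp_perm_dirichletMeasure hα (Equiv.swap 0 i))
  have hs : ∑ j : Fin (m + 1), α (Equiv.swap 0 i j.succ) = ∑ j with j ≠ i, α j := by
    have h1 := Fin.sum_univ_succ fun j => α (Equiv.swap 0 i j)
    have h2 := Finset.add_sum_erase Finset.univ α (Finset.mem_univ i)
    rw [Equiv.sum_comp (Equiv.swap 0 i) α, Equiv.swap_apply_left] at h1
    rw [Finset.filter_ne']
    linarith
  rw [hs] at h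
  simpa only [Function.comp_def, Equiv.swap_apply_left] using h

theorem mainTheorem2 {m : ℕ} (α : Fin (m + 1) → ℝ) (hα : ∀ i, 0 < α i) :
    IsProbabilityMeasure (dirichletMeasure α) ∧
    ∀ {Ω : Type*} [MeasurableSpace Ω] (P : Measure Ω) [IsProbabilityMeasure P]
      (X : Ω → Fin (m + 1) → ℝ), HasLaw X (dirichletMeasure α) P →
      -- marginal law of the first `k` coordinates, `k < n = m + 1`
      (∀ (k : ℕ) (hk : k < m + 1), ∃ c : ℝ, 0 < c ∧
        HasLaw (fun ω (i : Fin k) => X ω (Fin.castLE hk.le i))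
          ((volume : Measure (Fin k → ℝ)).withDensity fun x =>
            ENNReal.ofReal (c * simplexWeight (fun i : Fin k => α (Fin.castLE hk.le i))
              (∑ j ∈ Finset.univ.filter (fun j : Fin (m + 1) => k ≤ j.val), α j) x)) P) ∧
      -- one-dimensional marginals, `n ≥ 2`
      (2 ≤ m + 1 → ∀ i, HasLaw (fun ω => X ω i)
        (betaMeasure (α i) (∑ j : Fin (m + 1) with j ≠ i, α j)) P) ∧
      -- Gamma construction
      (∀ {Ω' : Type*} [MeasurableSpace Ω'] (P' : Measure Ω') [IsProbabilityMeasure P']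
        (Z : Fin (m + 1) → Ω' → ℝ),
        (∀ i, HasLaw (Z i) (gammaMeasure (α i) 1) P') → iIndepFun Z P' →
        IdentDistrib X (fun ω i => Z i ω / ∑ j, Z j ω) P P') ∧
      -- stick-breaking construction
      (∀ {Ω' : Type*} [MeasurableSpace Ω'] (P' : Measure Ω') [IsProbabilityMeasure P']
        (W : Fin m → Ω' → ℝ),
        (∀ i, HasLaw (W i)
          (betaMeasure (α i.castSucc) (∑ j : Fin (m + 1) with i.castSucc < j, α j)) P') →
        iIndepFun W P' →
        IdentDistrib X (fun ω => stickBreaking fun i => W i ω) P P') := by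
  refine ⟨isProbabilityMeasure_dirichletMeasure hα, fun P _ X hX => ⟨fun k hk => ?_, ?_, ?_, ?_⟩⟩
  · have hb : 0 < ∑ j : Fin (m + 1) with k ≤ j.val, α j :=
      Finset.sum_pos (fun j _ => hα j) ⟨⟨k, hk⟩, by simp⟩
    exact ⟨_, div_pos (Real.Gamma_pos_of_pos (add_pos_of_nonneg_of_pos
        (Finset.sum_nonneg fun i _ => (hα (Fin.castLE hk.le i)).le) hb))
        (mul_pos (Finset.prod_pos fun i _ => Real.Gamma_pos_of_pos (hα (Fin.castLE hk.le i)))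
          (Real.Gamma_pos_of_pos hb)),
      (measurePreserving_castLE_dirichletMeasure hα hk).hasLaw.fun_comp hX⟩
  · intro hm i
    obtain ⟨m, rfl⟩ : ∃ l, m = l + 1 := ⟨m - 1, by omega⟩
    exact (measurePreserving_eval_dirichletMeasure hα i).hasLaw.fun_comp hX
  · intro Ω' _ P' _ Z hZ hind
    have h := (measurePreserving_normalize_gammaMeasure hα).hasLaw.fun_comp (hind.hasLaw_pi hZ)
    exact ⟨hX.aemeasurable, h.aemeasurable, hX.map_eq.trans h.map_eq.symm⟩
  · intro Ω' _ P' _ W hW hind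
    have h := (measurePreserving_stickBreaking hα).hasLaw.fun_comp (hind.hasLaw_pi hW)
    exact ⟨hX.aemeasurable, h.aemeasurable, hX.map_eq.trans h.map_eq.symm⟩
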